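/- **Theorem (Negative Transfer Principle).** A *tangle* is a connected topological space $\mathcal T$ that is homeomorphic to a space obtained from finitely many disjoint copies of $[0,1]$ by identifying some of their endpoints. A point has degree $k$ if it has an open neighbourhood homeomorphic to $k$ copies of $[0,1)$ with all the $0$s identified, the point corresponding to the common $0$; points of degree $1$ or of degree at least $3$ are *singular*, and the connected components of the set of nonsingular points are the *edges* of $\mathcal T$. Every tangle is a drawing of a finite multigraph $G_{\mathcal T}$ whose vertices are the singular points and whose edges are the edges of $\mathcal T$ (for the circle, which has no singular points, $G_{\mathcal T}$ is one vertex with a loop). The *topological class* $\mathcal G(\mathcal T)$ consists of all multigraphs isomorphic to a subdivision of $G_{\mathcal T}$, a subdivision arising by inserting finitely many (possibly zero) new degree-2 vertices along edges. *Tangles.* A valuation $\nu$ of $\mathcal T$ assigns a nonnegative real number to every connected subset (including $\emptyset$). It is *monotone continuous* if $\nu(\emptyset)=0$, if $\nu(X)\le\nu(Y)$ whenever $X\subseteq Y$ are connected, and if the following holds. Identify the closure of each of the $m$ edges with a copy of $[0,1]$ (with its two endpoints glued, if the edge is a loop). For $z=(x_1,y_1,\dots,x_{2m},y_{2m})\in\mathbb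 R^{4m}$ let $X(z)$ be the closed set that is the union over $i=1,\dots,m$ of the sets corresponding, in the closure of the $i$-th edge, to $([x_{2i-1},y_{2i-1}]\cup[x_{2i},y_{2i}])\cap[0,1]$, where $[x,y]=\emptyset$ if $x>y$. Then $z\mapsto\nu(X(z))$ is continuous on the set of those $z$ for which $X(z)$ is connected. (The choice of identification does not matter.) The tangle $\mathcal T$ *guarantees connected envy-free allocations for $m$ agents* if, for all monotone continuous valuations $\nu_1,\dots,\nu_m$, there are pairwise disjoint connected (possibly empty) sets $T_1,\dots,T_m$ with union $\mathcal T$ such that $\nu_i(T_i)\ge\nu_i(T_j)$ for all $i,j$. The *gap threshold* of $\mathcal T$ is the least $t$ for which there is a set $X\subseteq\mathcal T$ of $t$ points such that $\mathcal T\setminus X$ is disconnected and has at least $t+2$ (finitely many) connected components; it is $\infty$ if there is no such $t$. *Graphs.* A set of vertices of a multigraph is *contiguous* if it is empty or induces a connected submultigraph. A multigraph $G$ with vertex set $V$ *guarantees contiguous EF$k_{\mathrm{outer}}$ allocations for $n$ agents* if, for all functions $\nu_1,\dots,\nu_n$ from subsets of $V$ to $\mathbb R$ with $\nu_i(\emptyset)=0$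 and $\nu_i(X)\le\nu_i(Y)$ for $X\subseteq Y$, there are pairwise disjoint contiguous (possibly empty) sets $A_1,\dots,A_n$ with union $V$ such that for all $i\ne j$ there is $S\subseteq A_j$ with $|S|\le k$, $A_j\setminus S$ contiguous and $\nu_i(A_i)\ge\nu_i(A_j\setminus S)$. For multigraphs write $K\succeq H$ if $K$ is isomorphic to a subdivision of $H$. *Eventually all* members of $\mathcal G(\mathcal T)$ have a property if there is $H\in\mathcal G(\mathcal T)$ such that every $K\in\mathcal G(\mathcal T)$ with $K\succeq H$ has the property. **Claim.** Let $\mathcal T$ be a tangle, and suppose that for some integer $m\ge 1$ it does not guarantee connected envy-free allocations for $m$ agents. Then for every integer $k\ge1$ and every integer $n$ greater than the gap threshold of $\mathcal T$, eventually all members of $\mathcal G(\mathcal T)$ fail to guarantee contiguous EF$k_{\mathrm{outer}}$ allocations for $n$ agents. -/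

import Mathlib

open scoped unitInterval NNReal

namespace TangledCakes

/-! ### Finite multigraphs -/

/-- A finite multigraph (loops and parallel edges allowed). The two ends of an edge `e` are
`endpt e false` and `endpt e true`; their order carries no meaning. -/
structure Multigraph where
  V : Type
  E : Type
  finV : Finite V
  finE : Finite E
  endpt : E → Bool → V

namespace Multigraph

/-- Multigraph isomorphism: bijections of vertices and edges preserving the unordered pair of
ends of each edge. -/
def IsIso (G H : Multigraph) : Prop :=
  ∃ (φ : G.V ≃ H.V) (ψ : G.E ≃ H.E), ∀ e : G.E,
    s(H.endpt (ψ e) false, H.endpt (ψ e) true)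
      = s(φ (G.endpt e false), φ (G.endpt e true))

/-- The `j`-th vertex, `0 ≤ j ≤ c e + 1`, on the path replacing the edge `e` when `c e` new
vertices are inserted on it. -/
def subdivNode (G : Multigraph) (c : G.E → ℕ) (e : G.E) (j : ℕ) :
    G.V ⊕ (Σ e : G.E, Fin (c e)) :=
  if j = 0 then Sum.inl (G.endpt e false)
  else if h : j - 1 < c e then Sum.inr ⟨e, ⟨j - 1, h⟩⟩
  else Sum.inl (G.endpt e true)

/-- The multigraph obtained from `G` by inserting `c e` new vertices of degree two along each
edge `e`. -/
def subdivide (G : Multigraph) (c : G.E → ℕ) : Multigraph where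
  V := G.V ⊕ (Σ e : G.E, Fin (c e))
  E := Σ e : G.E, Fin (c e + 1)
  finV := by
    have := G.finV
    have := G.finE
    infer_instance
  finE := by
    have := G.finE
    infer_instance
  endpt := fun s b =>
    if b then G.subdivNode c s.1 (s.2.val + 1) else G.subdivNode c s.1 s.2.val

/-- The subdivision order `H ⪰ G`: `H` is isomorphic to some subdivision of `G`. -/
def IsSubdivisionOf (H G : Multigraph) : Prop :=
  ∃ c : G.E → ℕ, IsIso H (G.subdivide c)

/-- Adjacency of distinct vertices of a multigraph. -/
def adjGraph (G : Multigraph) : SimpleGraph G.V where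
  Adj u v := u ≠ v ∧ ∃ e : G.E, s(G.endpt e false, G.endpt e true) = s(u, v)
  symm := ⟨by
    rintro u v ⟨huv, e, he⟩
    exact ⟨huv.symm, e, he.trans Sym2.eq_swap⟩⟩
  loopless := ⟨fun _ h => h.1 rfl⟩

/-- A set of vertices is contiguous if the subgraph it induces is connected; the empty set of
vertices is contiguous. -/
def Contiguous (G : Multigraph) (S : Set G.V) : Prop :=
  (G.adjGraph.induce S).Preconnected

end Multigraph

/-- An allocation of all of `α` to `n` agents in pairwise disjoint shares. -/
def IsAllocation {α : Type*} {n : ℕ} (A : Fin n → Set α) : Prop :=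
  Pairwise (fun i j => Disjoint (A i) (A j)) ∧ ⋃ i, A i = Set.univ

namespace Multigraph

/-- A monotone valuation of sets of vertices. -/
def MonotoneValuation (G : Multigraph) (ν : Set G.V → ℝ) : Prop :=
  ν ∅ = 0 ∧ ∀ X Y : Set G.V, X ⊆ Y → ν X ≤ ν Y

/-- `G` guarantees contiguous EF`k`-outer allocations for `n` agents with monotone
valuations. -/
def GuaranteesEFOuter (G : Multigraph) (k n : ℕ) : Prop :=
  ∀ ν : Fin n → Set G.V → ℝ, (∀ i, G.MonotoneValuation (ν i)) →
    ∃ A : Fin n → Set G.V, IsAllocation A ∧ (∀ i, G.Contiguous (A i)) ∧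
      ∀ i j, i ≠ j → ∃ S : Set G.V, S ⊆ A j ∧ S.ncard ≤ k ∧
        G.Contiguous (A j \ S) ∧ ν i (A j \ S) ≤ ν i (A i)

end Multigraph

/-! ### Tangles -/

/-- The endpoint `0` (for `false`) or `1` (for `true`) of the unit interval. -/
def endI (b : Bool) : I := if b then 1 else 0

theorem endI_injective : Function.Injective endI := by
  intro a b h
  cases a <;> cases b <;> simp_all [endI]

/-- Given copies of `[0,1]` indexed by `ι` and an equivalence relation `r` on their endpoints,
the relation identifying endpoints as prescribed by `r`. -/
def glueSetoid (ι : Type) (r : Setoid (ι × Bool)) : Setoid (Σ _ : ι, I) where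
  r p q := p = q ∨ ∃ i b j b', p = ⟨i, endI b⟩ ∧ q = ⟨j, endI b'⟩ ∧ r (i, b) (j, b')
  iseqv := by
    refine ⟨fun p => Or.inl rfl, ?_, ?_⟩
    · rintro p q (h | ⟨i, b, j, b', hp, hq, h⟩)
      · exact Or.inl h.symm
      · exact Or.inr ⟨j, b', i, b, hq, hp, r.symm h⟩
    · rintro p q s (rfl | ⟨i, b, j, b', hp, hq, h⟩) hqs
      · exact hqs
      · rcases hqs with rfl | ⟨i₂, b₂, j₂, b₂', hq₂, hs, h₂⟩
        · exact Or.inr ⟨i, b, j, b', hp, hq, h⟩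
        · have h3 : j = i₂ ∧ b' = b₂ := by
            rw [hq] at hq₂
            simp only [Sigma.mk.injEq, heq_eq_eq] at hq₂
            exact ⟨hq₂.1, endI_injective hq₂.2⟩
          obtain ⟨rfl, rfl⟩ := h3
          exact Or.inr ⟨i, b, j₂, b₂', hp, hs, r.trans h h₂⟩

/-- The quotient space of disjoint copies of `[0,1]`, indexed by `ι`, in which endpoints are
identified as prescribed by `r`. -/
abbrev Glue (ι : Type) (r : Setoid (ι × Bool)) : Type := Quotient (glueSetoid ι r)

/-- The point of the glued space given by the point `t` of the copy `i` of `[0,1]`. -/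
def Glue.mk {ι : Type} (r : Setoid (ι × Bool)) (i : ι) (t : I) : Glue ι r :=
  Quotient.mk (glueSetoid ι r) ⟨i, t⟩

/-- A tangle: a connected space that can be built from finitely many copies of `[0,1]` by
identifying some of their endpoints. -/
def IsTangle (T : Type*) [TopologicalSpace T] : Prop :=
  ConnectedSpace T ∧ ∃ (m : ℕ) (r : Setoid (Fin m × Bool)), Nonempty (T ≃ₜ Glue (Fin m) r)

/-- `k` copies of `[0,1)` with all the zeros identified, realised along the coordinate axes. -/
def Star (k : ℕ) : Type :=
  {p : Fin k → ℝ // (∀ i, 0 ≤ p i ∧ p i < 1) ∧ ∀ i j, i ≠ j → p i = 0 ∨ p j = 0}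

instance (k : ℕ) : TopologicalSpace (Star k) :=
  inferInstanceAs (TopologicalSpace {p : Fin k → ℝ //
    (∀ i, 0 ≤ p i ∧ p i < 1) ∧ ∀ i j, i ≠ j → p i = 0 ∨ p j = 0})

section Tangle

variable (T : Type*) [TopologicalSpace T]

/-- `x` has degree `k`: some open neighbourhood of `x` is homeomorphic to `k` open rays
spreading out from `x`. -/
def HasDegree {T : Type*} [TopologicalSpace T] (x : T) (k : ℕ) : Prop :=
  ∃ (U : Set T) (hx : x ∈ U) (f : U ≃ₜ Star k), IsOpen U ∧ ∀ i, (f ⟨x, hx⟩).1 i = 0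

/-- The singular points: those of degree `1` or of degree at least `3`. -/
def singularSet : Set T := {x | ∃ k, (k = 1 ∨ 3 ≤ k) ∧ HasDegree x k}

/-! ### Fair division of tangles -/

/-- A valuation assigns a nonnegative real number to every connected subset (the empty set
included). -/
abbrev Valuation : Type _ := {X : Set T // IsPreconnected X} → ℝ≥0

/-- The space glued from the edges of a multigraph at their common ends. -/
abbrev Multigraph.Realization (G : Multigraph) : Type :=
  Glue G.E (Setoid.ker fun p : G.E × Bool => G.endpt p.1 p.2)

/-- `h` exhibits `T` as a drawing of the multigraph `G` in which the vertices of `G` are exactly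
the singular points of `T`; the edges of `G` are then the tangle edges of `T`. A
circle has no singular points, and is drawn with one vertex placed anywhere on its only edge. -/
def IsDrawing (G : Multigraph) (h : G.Realization ≃ₜ T) : Prop :=
  (∀ v : G.V, ∃ e b, G.endpt e b = v) ∧
    (({x : T | ∃ e b, x = h (Glue.mk _ e (endI b))} = singularSet T) ∨
      (singularSet T = ∅ ∧ Nat.card G.V = 1))

/-- The closed set that meets each edge `e`, identified with `[0,1]`, in
`([x, y] ∪ [x', y']) ∩ [0,1]`, where `(x, y) = z (e, false)` and `(x', y') = z (e, true)`. Two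
intervals per edge are needed to describe all closed connected sets, as such a set may contain
two separate pieces of the same edge, at its two ends. -/
def coordSet {T : Type*} [TopologicalSpace T] {G : Multigraph} (h : G.Realization ≃ₜ T)
    (z : G.E × Bool → ℝ × ℝ) : Set T :=
  {p | ∃ (e : G.E) (b : Bool) (t : I),
    (t : ℝ) ∈ Set.Icc (z (e, b)).1 (z (e, b)).2 ∧ p = h (Glue.mk _ e t)}

/-- Monotone continuous valuations of a tangle. Any two identifications `h` of the tangle edges
with copies of `[0,1]` give the same notion of continuity. -/
def MonotoneContinuous {T : Type*} [TopologicalSpace T] (ν : Valuation T) : Prop :=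
  ν ⟨∅, isPreconnected_empty⟩ = 0 ∧
  (∀ X Y : {X : Set T // IsPreconnected X}, X.1 ⊆ Y.1 → ν X ≤ ν Y) ∧
  ∃ (G : Multigraph) (h : G.Realization ≃ₜ T), IsDrawing T G h ∧
    Continuous fun z : {z : G.E × Bool → ℝ × ℝ // IsPreconnected (coordSet h z)} =>
      ν ⟨coordSet h z.1, z.2⟩

/-- `T` guarantees connected envy-free allocations for `n` agents with monotone continuous
valuations. -/
def GuaranteesConnectedEF (n : ℕ) : Prop :=
  ∀ ν : Fin n → Valuation T, (∀ i, MonotoneContinuous (ν i)) →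
    ∃ (A : Fin n → Set T) (hA : ∀ i, IsPreconnected (A i)), IsAllocation A ∧
      ∀ i j, ν i ⟨A j, hA j⟩ ≤ ν i ⟨A i, hA i⟩

/-! ### The gap threshold -/

/-- `X` is a cutset of gap at least two: removing its points disconnects `T`, and leaves at
least `X.card + 2` (and finitely many) connected components. -/
def IsGapTwoCutset {T : Type*} [TopologicalSpace T] (X : Finset T) : Prop :=
  ¬ IsPreconnected ((X : Set T)ᶜ) ∧
    ∃ k : ℕ, 2 ≤ k ∧ Nat.card (ConnectedComponents ↥((X : Set T)ᶜ)) = X.card + k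

/-- The least cardinality of a cutset of gap at least two; `⊤` if there is none. -/
noncomputable def gapThreshold : ℕ∞ :=
  sInf {t : ℕ∞ | ∃ X : Finset T, IsGapTwoCutset X ∧ t = (X.card : ℕ∞)}

/-! ### The topological class of a tangle -/

/-- The topological class of `T`: all subdivisions (up to isomorphism) of the multigraph whose
vertices are the singular points of `T` and whose edges are the tangle edges of `T`. -/
def topologicalClass : Set Multigraph :=
  {H | ∃ (G : Multigraph) (h : G.Realization ≃ₜ T), IsDrawing T G h ∧ H.IsSubdivisionOf G}

/-- The final segment of the topological class determined by `H`. -/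
def finalSegment (H : Multigraph) : Set Multigraph :=
  {K | K ∈ topologicalClass T ∧ K.IsSubdivisionOf H}

/-- Eventually all members of the topological class of `T` have property `P`: the set of those
that do contains a final segment, that is, it lies in the final segment filter. -/
def EventuallyAll (P : Multigraph → Prop) : Prop :=
  ∃ H ∈ topologicalClass T, finalSegment T H ⊆ {K | K ∈ topologicalClass T ∧ P K}

end Tangle

end TangledCakes

/-! Let `X` be a set of `t < n` points whose removal leaves at least `t + 2` components. In a fine
enough subdivision the points of `X` in the drawing are all vertices and every component holds many
vertices. Further subdivision preserves this, so it suffices to defeat one such graph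
(`HasSeparation.not_guaranteesEFOuter`).

All agents count the vertices of a set `U` spread over `t + 2` of the components. One component gets
a large part of `U`, the others equal parts below the average share by more than `k`. Approximate
envy-freeness forces every share to within `k` of the average. A contiguous share avoiding the cut
vertices stays in one component, which must then be the large one. At most `t` shares contain a cut
vertex, so at least `n - t` shares crowd into the large part, which is too small for them.

The topological half, `exists_subdivide_hasSeparation`, produces the subdivision from a drawing and
`X`. -/

namespace TangledCakes

/-! ### Separations of multigraphs by few vertices, and their stability. -/

namespace Multigraph

/-- A labelling of the vertices and edges of `G` in which the unlabelled vertices, at most `t` in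
number, separate the labels from each other, and each label is carried by at least `N` vertices. -/
def HasSeparation (G : Multigraph) (L : Type*) (t N : ℕ) : Prop :=
  ∃ (vlab : G.V → Option L) (edgeLab : G.E → L),
    (∀ e b, vlab (G.endpt e b) = none ∨ vlab (G.endpt e b) = some (edgeLab e)) ∧
    {v | vlab v = none}.ncard ≤ t ∧ ∀ l, N ≤ {v | vlab v = some l}.ncard

theorem HasSeparation.of_isIso {G H : Multigraph} {L : Type*} {t N : ℕ}
    (hH : H.HasSeparation L t N) (hGH : IsIso G H) : G.HasSeparation L t N := by
  obtain ⟨vl, el, hends, hnone, hsome⟩ := hH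
  obtain ⟨φ, ψ, hφ⟩ := hGH
  have key (o : Option L) : {v | vl (φ v) = o}.ncard = {v | vl v = o}.ncard := by
    rw [← Set.ncard_image_of_injective {v | vl (φ v) = o} φ.injective]
    congr 1
    ext w
    simp only [Set.mem_image, Set.mem_ofPred_eq]
    exact ⟨fun ⟨v, hv, h⟩ => h ▸ hv, fun hw => ⟨φ.symm w, by simpa using hw, by simp⟩⟩
  refine ⟨fun v => vl (φ v), fun e => el (ψ e), fun e b => ?_, (key none).trans_le hnone,
    fun l => (hsome l).trans_eq (key (some l)).symm⟩
  have h0 := hends (ψ e) false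
  have h1 := hends (ψ e) true
  rcases Sym2.eq_iff.1 (hφ e) with ⟨ha, hb⟩ | ⟨ha, hb⟩ <;> rw [ha] at h0 <;> rw [hb] at h1 <;>
    cases b <;> assumption

/-- Every edge has a label, even one joining two unlabelled vertices, so new vertices inherit the
label of their edge: no cut vertex is added and no label class shrinks. -/
theorem HasSeparation.subdivide {G : Multigraph} {L : Type*} {t N : ℕ}
    (hG : G.HasSeparation L t N) (c : G.E → ℕ) : (G.subdivide c).HasSeparation L t N := by
  obtain ⟨vl, el, hends, hnone, hsome⟩ := hG
  have := G.finV
  have := (G.subdivide c).finV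
  have hnode (e : G.E) (j : ℕ) :
      Sum.elim vl (fun p => some (el p.1)) (G.subdivNode c e j) = none ∨
        Sum.elim vl (fun p => some (el p.1)) (G.subdivNode c e j) = some (el e) := by
    unfold subdivNode
    split_ifs
    · exact hends e false
    · exact Or.inr rfl
    · exact hends e true
  refine ⟨Sum.elim vl fun p => some (el p.1), fun p => el p.1, ?_, ?_, fun l => ?_⟩
  · rintro ⟨e, j⟩ b
    cases b
    · exact hnode e j
    · exact hnode e (j + 1)
  · refine le_trans (le_of_eq ?_) hnone
    rw [← Set.ncard_image_of_injective {v | vl v = none} (Sum.inl_injective (β := Σ e, Fin (c e)))]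
    congr 1
    ext v
    rcases v with v | v
    · exact ⟨fun hv => ⟨v, hv, rfl⟩, fun ⟨w, hw, hwv⟩ => by rw [← hwv]; exact hw⟩
    · exact ⟨fun hv => (Option.some_ne_none _ hv).elim, fun ⟨w, _, hwv⟩ => (Sum.inl_ne_inr hwv).elim⟩
  · refine (hsome l).trans ?_
    rw [← Set.ncard_image_of_injective {v | vl v = some l} (Sum.inl_injective (β := Σ e, Fin (c e)))]
    refine Set.ncard_le_ncard ?_ (Set.toFinite (α := (G.subdivide c).V) _)
    rintro _ ⟨v, hv, rfl⟩
    exact hv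

theorem IsIso.refl (G : Multigraph) : IsIso G G := ⟨Equiv.refl _, Equiv.refl _, fun _ => rfl⟩

/-- Adjacent labelled vertices both carry the label of the edge joining them, so the label is
constant along walks that avoid the cut vertices. -/
theorem Contiguous.label_eq {G : Multigraph} {L : Type*} {vl : G.V → Option L} {el : G.E → L}
    (hends : ∀ e b, vl (G.endpt e b) = none ∨ vl (G.endpt e b) = some (el e))
    {A : Set G.V} (hA : G.Contiguous A) (hcut : ∀ v ∈ A, vl v ≠ none)
    {u v : G.V} (hu : u ∈ A) (hv : v ∈ A) : vl u = vl v := by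
  have hadj (x y : G.V) (hx : x ∈ A) (hy : y ∈ A) (h : G.adjGraph.Adj x y) : vl x = vl y := by
    obtain ⟨-, e, he⟩ := h
    have h0 := hends e false
    have h1 := hends e true
    rcases Sym2.eq_iff.1 he with ⟨ha, hb⟩ | ⟨ha, hb⟩ <;> rw [ha] at h0 <;> rw [hb] at h1
    · rw [h0.resolve_left (hcut x hx), h1.resolve_left (hcut y hy)]
    · rw [h0.resolve_left (hcut y hy), h1.resolve_left (hcut x hx)]
  obtain ⟨w⟩ := hA ⟨u, hu⟩ ⟨v, hv⟩
  have walk {x y : A} (w : (G.adjGraph.induce A).Walk x y) : vl x = vl y := by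
    induction w with
    | nil => rfl
    | cons h _ ih => exact (hadj _ _ (Subtype.property _) (Subtype.property _) h).trans ih
  exact walk w

/-! ### The counting argument. -/

/-- If `t` vertices separate at least `t + 2` large sets of vertices, then agents who all count the
vertices in suitably sized subsets of these sets cannot be served. -/
theorem HasSeparation.not_guaranteesEFOuter {G : Multigraph} {L : Type*} [Finite L] {t k n N : ℕ}
    (htn : t < n) (hL : t + 2 ≤ Nat.card L)
    (hN : (n * k + 1) * (t + 1) + (n - t - 1) * ((n * k + 1) * (t + 2)) ≤ N)
    (hG : G.HasSeparation L t N) : ¬ G.GuaranteesEFOuter k n := by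
  classical
  intro hEF
  obtain ⟨vl, el, hends, hnone, hsome⟩ := hG
  have := G.finV
  have := Fintype.ofFinite G.V
  have := Fintype.ofFinite L
  obtain ⟨d, rfl⟩ : ∃ d, n = t + 1 + d := ⟨n - (t + 1), by omega⟩
  have hd : t + 1 + d - t - 1 = d := by omega
  rw [hd] at hN
  set n := t + 1 + d with hn
  -- `D` exceeds the slack `k` summed over all `n` agents.
  set D := n * k + 1 with hD
  -- the distinguished sets, one of which is larger than the others
  obtain ⟨g⟩ : Nonempty (Fin (t + 2) ↪ L) := by
    rw [Nat.card_eq_fintype_card] at hL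
    exact Function.Embedding.nonempty_of_card_le (by simpa using hL)
  -- The sizes make the average share exactly `D * (t + 2)`, which is `D` more than a small set. The
  -- large set exceeds `d` average shares by `D * (t + 1)`, so it falls `D` short of `d + 1` of
  -- them.
  let s : Fin (t + 2) → ℕ := fun i => if i = 0 then D * (t + 1) + d * (D * (t + 2)) else D * (t + 1)
  have hsN (i) : s i ≤ N := by
    simp only [s]
    split_ifs <;> nlinarith
  have hW (i : Fin (t + 2)) : ∃ W : Finset G.V, (∀ v ∈ W, vl v = some (g i)) ∧ W.card = s i := by
    have h1 : s i ≤ (Finset.univ.filter fun v => vl v = some (g i)).card := by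
      refine ((hsN i).trans (hsome (g i))).trans_eq ?_
      rw [← Set.ncard_coe_finset]
      congr 1
      ext v
      simp
    obtain ⟨W, hW, hc⟩ := Finset.exists_subset_card_eq h1
    exact ⟨W, fun v hv => by simpa using hW hv, hc⟩
  choose W hWlab hWcard using hW
  let U : Finset G.V := Finset.univ.biUnion W
  have hU : U.card = n * (D * (t + 2)) := by
    rw [Finset.card_biUnion]
    · simp only [hWcard, s]
      rw [Fin.sum_univ_succ]
      simp [Fin.succ_ne_zero]
      rw [hn]
      ring
    · intro i _ j _ hij
      refine Finset.disjoint_left.2 fun v hi hj => hij ?_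
      exact g.injective (Option.some_injective _ ((hWlab i v hi).symm.trans (hWlab j v hj)))
  obtain ⟨A, ⟨hdisj, hcover⟩, hcont, hfair⟩ := hEF (fun _ X => ((X ∩ U).ncard : ℝ)) (by
    refine fun _ => ⟨by simp, fun X Y hXY => ?_⟩
    exact Nat.cast_le.2 (Set.ncard_le_ncard (Set.inter_subset_inter_left _ hXY) (Set.toFinite _)))
  let a : Fin n → ℕ := fun i => (A i ∩ U).ncard
  have hak (i j) : a j ≤ a i + k := by
    by_cases hij : i = j
    · subst hij; omega
    obtain ⟨S, -, hSk, -, hle⟩ := hfair i j hij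
    have h1 : (A j \ S ∩ U).ncard ≤ a i := by exact_mod_cast hle
    have h2 : a j ≤ ((A j \ S ∩ U) ∪ S).ncard := by
      refine Set.ncard_le_ncard (fun v hv => ?_) (Set.toFinite _)
      by_cases hvS : v ∈ S
      · exact Or.inr hvS
      · exact Or.inl ⟨⟨hv.1, hvS⟩, hv.2⟩
    have h3 := Set.ncard_union_le (A j \ S ∩ ↑U) S
    omega
  have hcardset (X : Set G.V) : X.ncard = (Finset.univ.filter (· ∈ X)).card := by
    rw [← Set.ncard_coe_finset]
    congr 1
    ext v
    simp
  have hsub (J : Finset (Fin n)) (Y : Set G.V) (hY : ∀ i ∈ J, A i ∩ U ⊆ Y) :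
      ∑ i ∈ J, a i ≤ Y.ncard := by
    simp only [a, hcardset]
    rw [← Finset.card_biUnion]
    · refine Finset.card_le_card fun v hv => ?_
      simp only [Finset.mem_biUnion, Finset.mem_filter, Finset.mem_univ, true_and] at hv ⊢
      obtain ⟨i, hi, hv⟩ := hv
      exact hY i hi hv
    · intro i _ j _ hij
      refine Finset.disjoint_left.2 fun v hi hj => ?_
      simp only [Finset.mem_filter, Finset.mem_univ, true_and] at hi hj
      exact Set.disjoint_left.1 (hdisj hij) hi.1 hj.1
  have hsum : n * (D * (t + 2)) ≤ ∑ i, a i := by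
    rw [← hU]
    calc U.card ≤ (Finset.univ.biUnion fun i => Finset.univ.filter (· ∈ A i ∩ U)).card := by
          refine Finset.card_le_card fun v hv => ?_
          have : v ∈ ⋃ i, A i := hcover ▸ Set.mem_univ v
          simp only [Finset.mem_biUnion, Finset.mem_filter, Finset.mem_univ, true_and]
          obtain ⟨i, hi⟩ := Set.mem_iUnion.1 this
          exact ⟨i, hi, hv⟩
      _ ≤ _ := Finset.card_biUnion_le
      _ = ∑ i, a i := by
          refine Finset.sum_congr rfl fun i _ => ?_
          rw [← Set.ncard_coe_finset]
          congr 1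
          ext v
          simp
  -- Some share reaches the average, and no share is more than `k` below another.
  have hbig (i) : D * (t + 2) ≤ a i + k := by
    obtain ⟨j, -, hj⟩ : ∃ j ∈ (Finset.univ : Finset (Fin n)), D * (t + 2) ≤ a j := by
      refine Finset.exists_le_of_sum_le ⟨i, Finset.mem_univ i⟩ ?_
      simpa using hsum
    exact hj.trans (hak i j)
  -- the shares that contain an unlabelled vertex
  let B : Finset (Fin n) := Finset.univ.filter fun i => ∃ v ∈ A i, vl v = none
  have hB : B.card ≤ t := by
    have hpick (i : Fin n) : ∃ v, i ∈ B → v ∈ A i ∧ vl v = none := by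
      by_cases hi : i ∈ B
      · obtain ⟨v, hv⟩ := (Finset.mem_filter.1 hi).2
        exact ⟨v, fun _ => hv⟩
      -- A dummy value for `i ∉ B`; any vertex serves.
      · obtain ⟨v, -⟩ : U.Nonempty := Finset.card_pos.1 (by rw [hU]; positivity)
        exact ⟨v, fun h => absurd h hi⟩
    choose p hp using hpick
    refine le_trans ?_ hnone
    rw [hcardset]
    refine Finset.card_le_card_of_injOn p (fun i hi => by simpa using (hp i hi).2) ?_
    intro i hi j hj hij
    by_contra hne
    exact Set.disjoint_left.1 (hdisj hne) (hp i hi).1 (hij ▸ (hp j hj).1)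
  have hk : k ≤ n * k := Nat.le_mul_of_pos_left k (by omega)
  have hone (i : Fin n) (hi : i ∈ Bᶜ) : A i ∩ U ⊆ W 0 := by
    have hcut : ∀ v ∈ A i, vl v ≠ none := by
      intro v hv h0
      simp only [B, Finset.mem_compl, Finset.mem_filter, Finset.mem_univ, true_and] at hi
      exact hi ⟨v, hv, h0⟩
    rintro v ⟨hv, hvU⟩
    obtain ⟨q, -, hq⟩ := Finset.mem_biUnion.1 (Finset.mem_coe.1 hvU)
    have hWq : A i ∩ U ⊆ W q := by
      rintro w ⟨hw, hwU⟩
      obtain ⟨q', -, hq'⟩ := Finset.mem_biUnion.1 (Finset.mem_coe.1 hwU)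
      have h1 := (hcont i).label_eq hends hcut hv hw
      rw [hWlab q v hq, hWlab q' w hq'] at h1
      rw [g.injective (Option.some_injective _ h1)]
      exact hq'
    by_cases hq0 : q = 0
    · rw [← hq0]; exact hq
    -- A share inside a small set has at most `D * (t + 1)` counted vertices, contradicting `hbig`
    -- because `k < D`.
    have h1 : a i ≤ s q := by
      rw [← hWcard q, ← Set.ncard_coe_finset]
      exact Set.ncard_le_ncard hWq (Set.toFinite _)
    have h2 := hbig i
    simp only [s, hq0, if_false] at h1
    nlinarith
  have h1 := hsub Bᶜ (W 0) hone
  rw [Set.ncard_coe_finset, hWcard] at h1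
  have h2 := Finset.sum_le_sum fun i (_ : i ∈ Bᶜ) => hbig i
  rw [Finset.sum_const, Finset.sum_add_distrib, Finset.sum_const, smul_eq_mul, smul_eq_mul] at h2
  -- At least `n - t = d + 1` shares lie in `W 0` as far as `U` is concerned; their total deficit is
  -- at most `n * k < D`, so they need more than `W 0` holds.
  have h3 : d + 1 ≤ Bᶜ.card := by
    rw [Finset.card_compl, Fintype.card_fin]
    omega
  have h4 : Bᶜ.card ≤ n := by simpa using Finset.card_le_univ Bᶜ
  have h5 : Bᶜ.card * k ≤ n * k := Nat.mul_le_mul_right k h4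
  have h6 : (d + 1) * (D * (t + 2)) ≤ Bᶜ.card * (D * (t + 2)) := Nat.mul_le_mul_right _ h3
  simp only [s, if_true] at h1
  nlinarith

end Multigraph

/-! ### Cutting a drawing at finitely many points -/

section Drawing

variable {T : Type*} [TopologicalSpace T]

/-- The connected component of `x` in the complement of `X`; `none` if `x` lies in `X`. -/
noncomputable def componentAwayFrom (X : Finset T) (x : T) :
    Option (ConnectedComponents ↥((X : Set T)ᶜ)) :=
  open Classical in if hx : x ∈ (X : Set T)ᶜ then some (ConnectedComponents.mk ⟨x, hx⟩) else none

theorem componentAwayFrom_eq_none {X : Finset T} {x : T} :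
    componentAwayFrom X x = none ↔ x ∈ X := by
  simp [componentAwayFrom]

theorem componentAwayFrom_eq_of_isPreconnected {X : Finset T} {S : Set T} (hS : IsPreconnected S)
    (hSX : ∀ x ∈ S, x ∉ X) {x y : T} (hx : x ∈ S) (hy : y ∈ S) :
    componentAwayFrom X x = componentAwayFrom X y := by
  have hx' : x ∈ (X : Set T)ᶜ := hSX x hx
  have hy' : y ∈ (X : Set T)ᶜ := hSX y hy
  have hS' : IsPreconnected ((↑) ⁻¹' S : Set ↥((X : Set T)ᶜ)) := by
    rw [← Topology.IsInducing.subtypeVal.isPreconnected_image, Subtype.image_preimage_coe,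
      Set.inter_eq_right.2 (show S ⊆ (X : Set T)ᶜ from hSX)]
    exact hS
  simp only [componentAwayFrom, hx', hy', dif_pos, Option.some.injEq]
  exact ConnectedComponents.coe_eq_coe'.2
    (hS'.subset_connectedComponent (x := ⟨y, hy'⟩) hy (show x ∈ S from hx))

variable {G : Multigraph} (h : G.Realization ≃ₜ T)

/-- The arc drawing the edge `e`, with parameters outside `[0,1]` clamped. -/
noncomputable def drawnArc (e : G.E) (s : ℝ) : T :=
  h (Glue.mk _ e (Set.projIcc 0 1 zero_le_one s))

theorem continuous_drawnArc (e : G.E) : Continuous (drawnArc h e) := by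
  refine h.continuous.comp (continuous_quotient_mk'.comp ?_)
  exact continuous_sigmaMk.comp continuous_projIcc

/-- Gluing identifies endpoints only, so it is enough that one of the two parameters is interior. -/
theorem drawnArc_eq_drawnArc {e e' : G.E} {s s' : ℝ} (hs : s ∈ Set.Ioo (0 : ℝ) 1)
    (hs' : s' ∈ Set.Icc (0 : ℝ) 1) (heq : drawnArc h e s = drawnArc h e' s') :
    e = e' ∧ s = s' := by
  have h1 := Quotient.exact (h.injective heq)
  rw [Set.projIcc_of_mem zero_le_one (Set.Ioo_subset_Icc_self hs),
    Set.projIcc_of_mem zero_le_one hs'] at h1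
  rcases h1 with h1 | ⟨i, b, -, -, h1, -⟩
  · simpa using h1
  · simp only [Sigma.mk.injEq, heq_eq_eq] at h1
    have h2 : s = (endI b : I) := congrArg Subtype.val h1.2
    cases b <;> simp [endI] at h2 <;> simp [h2] at hs

theorem drawnArc_endpoint (e : G.E) (b : Bool) :
    drawnArc h e (if b then 1 else 0) = h (Glue.mk _ e (endI b)) := by
  cases b <;> simp [drawnArc, endI]

theorem drawnEnd_eq_iff {e e' : G.E} {b b' : Bool} :
    h (Glue.mk _ e (endI b)) = h (Glue.mk _ e' (endI b')) ↔ G.endpt e b = G.endpt e' b' := by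
  rw [h.injective.eq_iff]
  constructor
  · intro heq
    rcases Quotient.exact heq with h1 | ⟨i, c, j, c', h1, h2, h3⟩
    · simp only [Sigma.mk.injEq, heq_eq_eq] at h1
      rw [h1.1, endI_injective h1.2]
    · simp only [Sigma.mk.injEq, heq_eq_eq] at h1 h2
      rw [h1.1, h2.1, endI_injective h1.2, endI_injective h2.2]
      exact h3
  · exact fun heq => Quotient.sound (Or.inr ⟨e, b, e', b', rfl, rfl, heq⟩)

theorem finite_drawnArc_mem (X : Finset T) (e : G.E) :
    {s ∈ Set.Ioo (0 : ℝ) 1 | drawnArc h e s ∈ X}.Finite := by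
  refine Set.Finite.of_finite_image (f := drawnArc h e) (X.finite_toSet.subset ?_) ?_
  · rintro _ ⟨s, hs, rfl⟩
    exact hs.2
  · exact fun s hs s' hs' heq =>
      (drawnArc_eq_drawnArc h hs.1 (Set.Ioo_subset_Icc_self hs'.1) heq).2

/-- Every component left by a finite set of points contains infinitely many interior points of
some edge. -/
theorem exists_infinite_component_drawnArc (h : G.Realization ≃ₜ T) (X : Finset T)
    (l : ConnectedComponents ↥((X : Set T)ᶜ)) :
    ∃ e : G.E, {s ∈ Set.Ioo (0 : ℝ) 1 | componentAwayFrom X (drawnArc h e s) = some l}.Infinite := by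
  obtain ⟨⟨x, hx⟩, rfl⟩ := ConnectedComponents.surjective_coe l
  obtain ⟨p, rfl⟩ := h.surjective x
  induction p using Quotient.inductionOn with | h p
  obtain ⟨e, u⟩ := p
  have hu : drawnArc h e u = h (Glue.mk _ e u) := by rw [drawnArc, Set.projIcc_val]
  have hx' : drawnArc h e u ∉ X := hu ▸ hx
  have hcomp : componentAwayFrom X (drawnArc h e u) = some (ConnectedComponents.mk ⟨_, hx⟩) := by
    rw [hu, componentAwayFrom]
    exact dif_pos hx
  refine ⟨e, ?_⟩
  -- nearby interior parameters avoid `X`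
  have hfin := finite_drawnArc_mem h X e
  have hnhds : {s ∈ Set.Ioo (0 : ℝ) 1 | drawnArc h e s ∈ X}ᶜ ∈ nhds (u : ℝ) :=
    hfin.isClosed.isOpen_compl.mem_nhds fun hmem => hx' hmem.2
  obtain ⟨ε, hε, hball⟩ := Metric.mem_nhds_iff.1 hnhds
  have hu0 := u.2.1
  have hu1 := u.2.2
  -- The point may be an end of the edge, so its neighbourhood is clipped to the open interval.
  have hlt : max 0 ((u : ℝ) - ε) < min 1 ((u : ℝ) + ε) := by
    rw [max_lt_iff, lt_min_iff, lt_min_iff]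
    refine ⟨⟨?_, ?_⟩, ?_, ?_⟩ <;> linarith
  refine (Set.Ioo_infinite hlt).mono fun s hs => ?_
  obtain ⟨⟨hs0, hsl⟩, hs1, hsr⟩ :=
    show (0 < s ∧ (u : ℝ) - ε < s) ∧ s < 1 ∧ s < (u : ℝ) + ε from
      ⟨max_lt_iff.1 hs.1, lt_min_iff.1 hs.2⟩
  refine ⟨⟨hs0, hs1⟩, ?_⟩
  rw [← hcomp]
  refine componentAwayFrom_eq_of_isPreconnected
    (isPreconnected_uIcc.image _ (continuous_drawnArc h e).continuousOn) ?_
    (Set.mem_image_of_mem _ (Set.right_mem_uIcc (a := (u : ℝ))))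
    (Set.mem_image_of_mem _ Set.left_mem_uIcc)
  rintro _ ⟨v, hv, rfl⟩ hvX
  rcases eq_or_ne v (u : ℝ) with rfl | hvu
  · exact hx' hvX
  rcases Set.mem_uIcc.1 hv with ⟨h1, h2⟩ | ⟨h1, h2⟩
  · have h3 := lt_of_le_of_ne h1 hvu.symm
    refine hball (a := v) ?_ ⟨⟨by linarith, by linarith⟩, hvX⟩
    rw [Metric.mem_ball, Real.dist_eq, abs_lt]
    constructor <;> linarith
  · have h3 := lt_of_le_of_ne h2 hvu
    refine hball (a := v) ?_ ⟨⟨by linarith, by linarith⟩, hvX⟩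
    rw [Metric.mem_ball, Real.dist_eq, abs_lt]
    constructor <;> linarith

/-! ### Realising a subdivision inside the drawing. -/

/-- The `j`-th node of the partition of `[0,1]` by the points of `F ⊆ (0,1)`. -/
noncomputable def partitionNode (F : Finset ℝ) (j : ℕ) : ℝ :=
  if j = 0 then 0 else if hj : j - 1 < F.card then F.orderEmbOfFin rfl ⟨j - 1, hj⟩ else 1

theorem partitionNode_mem_Icc {F : Finset ℝ} (hF : ∀ s ∈ F, s ∈ Set.Ioo (0 : ℝ) 1) (j : ℕ) :
    partitionNode F j ∈ Set.Icc (0 : ℝ) 1 := by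
  unfold partitionNode
  split_ifs with _ hj
  · simp
  · exact Set.Ioo_subset_Icc_self (hF _ (F.orderEmbOfFin_mem rfl _))
  · simp

theorem partitionNode_lt_succ {F : Finset ℝ} (hF : ∀ s ∈ F, s ∈ Set.Ioo (0 : ℝ) 1) {j : ℕ}
    (hj : j ≤ F.card) : partitionNode F j < partitionNode F (j + 1) := by
  have hmem (i) := hF _ (F.orderEmbOfFin_mem rfl i)
  unfold partitionNode
  rcases j with _ | j
  · simp only [if_true, Nat.add_eq_zero_iff, one_ne_zero, and_false, if_false]
    split_ifs
    · exact (hmem _).1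
    · exact zero_lt_one
  · have hj' : j < F.card := hj
    simp only [Nat.add_eq_zero_iff, one_ne_zero, and_false, if_false, Nat.add_sub_cancel, hj',
      dif_pos]
    split_ifs
    · exact (F.orderEmbOfFin rfl).strictMono (by simp [Fin.lt_def])
    · exact (hmem _).2

theorem notMem_of_mem_Ioo_partitionNode {F : Finset ℝ} {j : ℕ} (hjF : j ≤ F.card) {s : ℝ}
    (hs : s ∈ Set.Ioo (partitionNode F j) (partitionNode F (j + 1))) : s ∉ F := by
  intro hsF
  obtain ⟨i, rfl⟩ : s ∈ Set.range (F.orderEmbOfFin rfl) := by rwa [F.range_orderEmbOfFin]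
  obtain ⟨h1, h2⟩ := hs
  have hij : j ≤ i.1 := by
    by_contra! hlt
    have hj0 : j ≠ 0 := by omega
    have hj : j - 1 < F.card := by omega
    simp only [partitionNode, hj0, if_false, hj, dif_pos] at h1
    have := (F.orderEmbOfFin rfl).lt_iff_lt.1 h1
    rw [Fin.lt_def] at this
    simp at this
    omega
  have hj : j < F.card := hij.trans_lt i.2
  simp only [partitionNode, Nat.add_eq_zero_iff, one_ne_zero, and_false, if_false,
    Nat.add_sub_cancel, hj, dif_pos] at h2
  have := (F.orderEmbOfFin rfl).lt_iff_lt.1 h2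
  rw [Fin.lt_def] at this
  simp at this
  omega

/-- The points at which the vertices of a subdivision are drawn: the new vertices on each edge have
the points of `F` as parameters, and each old vertex is given as an end of an edge. -/
noncomputable def drawnVertex (F : Finset ℝ) (end₀ : G.V → G.E × Bool) :
    (G.subdivide fun _ => F.card).V → T :=
  Sum.elim (fun v => h (Glue.mk _ (end₀ v).1 (endI (end₀ v).2)))
    fun p => drawnArc h p.1 (F.orderEmbOfFin rfl p.2)

/-- `partitionNode` splits cases exactly as `subdivNode` does. The choice of `end₀` is immaterial,
since all edge ends at a vertex are drawn at one point. -/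
theorem drawnVertex_subdivNode (F : Finset ℝ) {end₀ : G.V → G.E × Bool}
    (hend : ∀ v, G.endpt (end₀ v).1 (end₀ v).2 = v) (e : G.E) (j : ℕ) :
    drawnVertex h F end₀ (G.subdivNode (fun _ => F.card) e j)
      = drawnArc h e (partitionNode F j) := by
  unfold Multigraph.subdivNode partitionNode
  split_ifs
  · exact ((drawnEnd_eq_iff h).2 (hend _)).trans (drawnArc_endpoint h e false).symm
  · rfl
  · exact ((drawnEnd_eq_iff h).2 (hend _)).trans (drawnArc_endpoint h e true).symm

theorem drawnVertex_injective {F : Finset ℝ} (hF : ∀ s ∈ F, s ∈ Set.Ioo (0 : ℝ) 1)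
    {end₀ : G.V → G.E × Bool} (hend : ∀ v, G.endpt (end₀ v).1 (end₀ v).2 = v) :
    Function.Injective (drawnVertex h F end₀) := by
  have hmem (i) := hF _ (F.orderEmbOfFin_mem rfl i)
  have hne (v : G.V) (p : Σ _ : G.E, Fin F.card) :
      drawnVertex h F end₀ (Sum.inr p) ≠ drawnVertex h F end₀ (Sum.inl v) := by
    intro heq
    have h1 : drawnArc h p.1 (F.orderEmbOfFin rfl p.2) = _ :=
      heq.trans (drawnArc_endpoint h (end₀ v).1 (end₀ v).2).symm
    have h2 := (drawnArc_eq_drawnArc h (hmem _) (by split_ifs <;> simp) h1).2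
    have h3 := hmem p.2
    rw [h2] at h3
    split_ifs at h3 <;> simp at h3
  rintro (v | ⟨e, i⟩) (v' | ⟨e', i'⟩) heq
  · have h1 := (drawnEnd_eq_iff h).1 heq
    rw [hend, hend] at h1
    rw [h1]
  · exact absurd heq.symm (hne _ _)
  · exact absurd heq (hne _ _)
  · obtain ⟨rfl, h1⟩ := drawnArc_eq_drawnArc h (hmem _) (Set.Ioo_subset_Icc_self (hmem _)) heq
    obtain rfl : i = i' := (F.orderEmbOfFin rfl).injective h1
    rfl

/-- Finitely many points of a drawing become vertices of a subdivision, in which they separate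
arbitrarily many vertices of each component that is left when they are removed. -/
theorem exists_subdivide_hasSeparation (h : G.Realization ≃ₜ T)
    (hvert : ∀ v : G.V, ∃ e b, G.endpt e b = v) (X : Finset T)
    [Finite (ConnectedComponents ↥((X : Set T)ᶜ))] (N : ℕ) :
    ∃ c, (G.subdivide c).HasSeparation (ConnectedComponents ↥((X : Set T)ᶜ)) X.card N := by
  classical
  have := G.finE
  have := Fintype.ofFinite G.E
  have := Fintype.ofFinite (ConnectedComponents ↥((X : Set T)ᶜ))
  choose e₀ b₀ hend using hvert
  choose e₁ he₁ using exists_infinite_component_drawnArc h X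
  choose P hP hPcard using fun l => (he₁ l).exists_subset_card_eq N
  -- The same parameters are used on every edge; superfluous vertices do no harm. The first part
  -- puts all interior points of `X` among the vertices, the second puts `N` vertices in each
  -- component.
  let F : Finset ℝ := (Finset.univ.biUnion fun e => (finite_drawnArc_mem h X e).toFinset) ∪
    Finset.univ.biUnion P
  have hF : ∀ s ∈ F, s ∈ Set.Ioo (0 : ℝ) 1 := by
    intro s hs
    rcases Finset.mem_union.1 hs with hs | hs
    · obtain ⟨e, -, hs⟩ := Finset.mem_biUnion.1 hs
      exact ((Set.Finite.mem_toFinset _).1 hs).1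
    · obtain ⟨l, -, hs⟩ := Finset.mem_biUnion.1 hs
      exact (hP l hs).1
  have hcut (e : G.E) (s : ℝ) (hs : s ∈ Set.Ioo (0 : ℝ) 1) (hsF : s ∉ F) :
      drawnArc h e s ∉ X := fun hsX =>
    hsF (Finset.mem_union_left _ (Finset.mem_biUnion.2 ⟨e, Finset.mem_univ _, by
      simpa using ⟨hs, hsX⟩⟩))
  have hPF (l) : ∀ s ∈ P l, s ∈ F := fun s hs =>
    Finset.mem_union_right _ (Finset.mem_biUnion.2 ⟨l, Finset.mem_univ _, hs⟩)
  clear_value F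
  have hgap (e : G.E) {j : ℕ} (hj : j ≤ F.card) :
      ∀ s ∈ Set.Ioo (partitionNode F j) (partitionNode F (j + 1)), drawnArc h e s ∉ X :=
    fun s hs => hcut e s ⟨(partitionNode_mem_Icc hF j).1.trans_lt hs.1,
      hs.2.trans_le (partitionNode_mem_Icc hF (j + 1)).2⟩ (notMem_of_mem_Ioo_partitionNode hj hs)
  -- An open piece between consecutive nodes misses `X`, so its midpoint determines the label of the
  -- corresponding edge of the subdivision.
  let mid (j : ℕ) : ℝ := (partitionNode F j + partitionNode F (j + 1)) / 2
  have hmid {j : ℕ} (hj : j ≤ F.card) :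
      mid j ∈ Set.Ioo (partitionNode F j) (partitionNode F (j + 1)) := by
    have := partitionNode_lt_succ hF hj
    constructor <;> simp only [mid] <;> linarith
  have hlab (p : Σ _ : G.E, Fin (F.card + 1)) :
      ∃ l, componentAwayFrom X (drawnArc h p.1 (mid p.2)) = some l :=
    Option.ne_none_iff_exists'.1 fun h0 => hgap p.1 (Nat.lt_succ_iff.1 p.2.2) _
      (hmid (Nat.lt_succ_iff.1 p.2.2)) (componentAwayFrom_eq_none.1 h0)
  choose lab hlab using hlab
  let pos := drawnVertex h F fun v => (e₀ v, b₀ v)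
  have hpos : Function.Injective pos := drawnVertex_injective h hF hend
  have hends (e : G.E) (j : ℕ) (hj : j ≤ F.card) (s : ℝ)
      (hs : s = partitionNode F j ∨ s = partitionNode F (j + 1)) :
      componentAwayFrom X (drawnArc h e s) = none ∨
        componentAwayFrom X (drawnArc h e s) = componentAwayFrom X (drawnArc h e (mid j)) := by
    -- An end of the piece that is not in `X` is joined to the midpoint by an arc avoiding `X`.
    refine or_iff_not_imp_left.2 fun hsX => ?_
    rw [componentAwayFrom_eq_none] at hsX
    refine componentAwayFrom_eq_of_isPreconnected
      (isPreconnected_uIcc.image _ (continuous_drawnArc h e).continuousOn) ?_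
      (Set.mem_image_of_mem _ (Set.left_mem_uIcc (b := mid j)))
      (Set.mem_image_of_mem _ Set.right_mem_uIcc)
    rintro _ ⟨v, hv, rfl⟩
    rcases eq_or_ne v s with rfl | hvs
    · exact hsX
    have hm := hmid hj
    refine hgap e hj v ?_
    rcases Set.mem_uIcc.1 hv with ⟨h1, h2⟩ | ⟨h1, h2⟩
    · have h3 := lt_of_le_of_ne h1 hvs.symm
      rcases hs with rfl | rfl
      · exact ⟨h3, h2.trans_lt hm.2⟩
      · exact absurd (h3.trans_le h2) hm.2.not_gt
    · have h3 := lt_of_le_of_ne h2 hvs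
      rcases hs with rfl | rfl
      · exact absurd (h1.trans_lt h3) hm.1.not_gt
      · exact ⟨hm.1.trans_le h1, h3⟩
  refine ⟨fun _ => F.card, fun v => componentAwayFrom X (pos v), lab, ?_, ?_, fun l => ?_⟩
  · rintro ⟨e, j⟩ b
    have hnode (i : ℕ) : pos (G.subdivNode (fun _ => F.card) e i) = drawnArc h e (partitionNode F i) :=
      drawnVertex_subdivNode h F hend e i
    rw [← hlab ⟨e, j⟩]
    cases b
    · change componentAwayFrom X (pos (G.subdivNode _ e j)) = _ ∨
        componentAwayFrom X (pos (G.subdivNode _ e j)) = _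
      rw [hnode]
      exact hends e j (Nat.lt_succ_iff.1 j.2) _ (Or.inl rfl)
    · change componentAwayFrom X (pos (G.subdivNode _ e (j + 1))) = _ ∨
        componentAwayFrom X (pos (G.subdivNode _ e (j + 1))) = _
      rw [hnode]
      exact hends e j (Nat.lt_succ_iff.1 j.2) _ (Or.inr rfl)
  · rw [← Set.ncard_coe_finset X]
    exact Set.ncard_le_ncard_of_injOn pos (fun v hv => componentAwayFrom_eq_none.1 hv)
      hpos.injOn X.finite_toSet
  · have := (G.subdivide fun _ => F.card).finV
    rw [← hPcard l, ← Set.ncard_coe_finset,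
      ← Set.InjOn.ncard_image (f := drawnArc h (e₁ l)) (s := (P l : Set ℝ)),
      ← Set.ncard_image_of_injective _ hpos]
    · refine Set.ncard_le_ncard ?_ (Set.toFinite _)
      rintro _ ⟨s, hs, rfl⟩
      obtain ⟨i, rfl⟩ : s ∈ Set.range (F.orderEmbOfFin rfl) := by
        rw [F.range_orderEmbOfFin]
        exact hPF l s hs
      exact ⟨Sum.inr ⟨e₁ l, i⟩, (hP l hs).2, rfl⟩
    · exact fun s hs s' hs' heq => (drawnArc_eq_drawnArc h (hP l hs).1
        (Set.Ioo_subset_Icc_self (hP l hs').1) heq).2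

end Drawing

end TangledCakes

/-! ### The negative transfer principle. -/

theorem mainTheorem2 {T : Type*} [TopologicalSpace T] (hT : TangledCakes.IsTangle T)
    (hfail : ∃ m : ℕ, 1 ≤ m ∧ ¬ TangledCakes.GuaranteesConnectedEF T m)
    (k : ℕ) (hk : 1 ≤ k) (n : ℕ) (hn : TangledCakes.gapThreshold T < (n : ℕ∞)) :
    TangledCakes.EventuallyAll T (fun G => ¬ G.GuaranteesEFOuter k n) := by
  -- a drawing of `T` comes with any monotone continuous valuation
  obtain ⟨G, h, hdraw⟩ : ∃ (G : TangledCakes.Multigraph) (h : G.Realization ≃ₜ T),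
      TangledCakes.IsDrawing T G h := by
    obtain ⟨m, hm, hfail⟩ := hfail
    simp only [TangledCakes.GuaranteesConnectedEF, not_forall] at hfail
    obtain ⟨ν, hν, -⟩ := hfail
    obtain ⟨-, -, G, h, hdraw, -⟩ := hν ⟨0, hm⟩
    exact ⟨G, h, hdraw⟩
  obtain ⟨_, ⟨X, ⟨-, q, hq, hcard⟩, rfl⟩, hXn⟩ := sInf_lt_iff.1 hn
  have hXn : X.card < n := by exact_mod_cast hXn
  -- `Nat.card` is `0` on infinite types, so a count of at least `2` gives finiteness.
  have : Finite (ConnectedComponents ↥((X : Set T)ᶜ)) := Nat.finite_of_card_ne_zero (by omega)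
  obtain ⟨c, hc⟩ := TangledCakes.exists_subdivide_hasSeparation h hdraw.1 X
    ((n * k + 1) * (X.card + 1) + (n - X.card - 1) * ((n * k + 1) * (X.card + 2)))
  refine ⟨G.subdivide c, ⟨G, h, hdraw, c, TangledCakes.Multigraph.IsIso.refl _⟩, ?_⟩
  rintro K ⟨hK, c', hiso⟩
  exact ⟨hK, ((hc.subdivide c').of_isIso hiso).not_guaranteesEFOuter hXn (by omega) le_rfl⟩
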